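/- Let $M$ be a smooth manifold (finite-dimensional, without boundary). The class of a smooth $1$-form $\eta\in\Omega^1(M)$ at a point $x\in M$ is the codimension in $\mathrm{T}_xM$ of $\mathrm{Ker}\,\eta_x\cap\mathrm{Ker}\,\mathrm{d}\eta_x$, where $\mathrm{Ker}\,\mathrm{d}\eta_x=\{v\in \mathrm{T}_xM \mid \mathrm{d}\eta_x(v,w)=0 \text{ for all } w\in \mathrm{T}_xM\}$. Let $\eta\in\Omega^1(M)$ be a nowhere-vanishing $1$-form whose class is equal to $2r$ at every point of $M$. Then, for any point $x\in M$, there exist an open neighbourhood $V$ of $x$ and a nowhere-vanishing smooth function $g\in\mathscr{C}^\infty(V)$ such that the $1$-form $g\,\eta|_V$ has class $2r-1$ at every point of $V$. -/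

import Mathlib

open scoped Manifold ContDiff Topology

noncomputable section

namespace PrecontactClass

/-! ### Pairs of a 1-form and a 2-form on a vector space -/

section LinearAlgebra

variable {T : Type*} [AddCommGroup T] [Module ℝ T] [TopologicalSpace T]

/-- The kernel `{v | i_v β = 0}` of an alternating 2-form `β`, where `i_v β` is `β (v, ·)`. -/
def twoFormKer (β : T [⋀^Fin 2]→L[ℝ] ℝ) : Submodule ℝ T :=
  LinearMap.ker β.toAlternatingMap.curryLeft

theorem mem_twoFormKer {β : T [⋀^Fin 2]→L[ℝ] ℝ} {v : T} :
    v ∈ twoFormKer β ↔ ∀ w : T, β ![v, w] = 0 := by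
  rw [twoFormKer, LinearMap.mem_ker]
  constructor
  · intro h w
    exact DFunLike.congr_fun h ![w]
  · intro h
    ext m
    have hm : m = ![m 0] := by
      ext i
      fin_cases i
      rfl
    rw [hm]
    exact h (m 0)

/-- The characteristic space `Ker τ ∩ Ker β` of the pair `(τ, β)`. -/
def charSpace (τ : T →L[ℝ] ℝ) (β : T [⋀^Fin 2]→L[ℝ] ℝ) : Submodule ℝ T :=
  LinearMap.ker (τ : T →ₗ[ℝ] ℝ) ⊓ twoFormKer β

/-- The class of the pair `(τ, β)`: the codimension of its characteristic space. -/
def pairClass (τ : T →L[ℝ] ℝ) (β : T [⋀^Fin 2]→L[ℝ] ℝ) : ℕ :=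
  Module.finrank ℝ (T ⧸ charSpace τ β)

end LinearAlgebra

/-! ### 1-forms on a manifold -/

section Manifold

variable {E : Type*} [NormedAddCommGroup E] [NormedSpace ℝ E]
  {M : Type*} [TopologicalSpace M] [ChartedSpace E M]

/-- A field of covectors `η` is a smooth 1-form if it is a smooth section of the cotangent
bundle. -/
def IsSmoothOneForm [IsManifold 𝓘(ℝ, E) ∞ M]
    (η : (x : M) → (TangentSpace 𝓘(ℝ, E) x →L[ℝ] ℝ)) : Prop :=
  ContMDiff 𝓘(ℝ, E) (𝓘(ℝ, E).prod 𝓘(ℝ, E →L[ℝ] ℝ)) ∞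
    (fun x ↦ Bundle.TotalSpace.mk' (E →L[ℝ] ℝ)
      (E := fun x : M ↦ (TangentSpace 𝓘(ℝ, E) x →L[ℝ] ℝ)) x (η x))

/-- The expression of the 1-form `η` in the preferred chart at `x`: its pullback by the inverse
of that chart, seen as an alternating 1-form on the model space. -/
def oneFormInChart (η : (x : M) → (TangentSpace 𝓘(ℝ, E) x →L[ℝ] ℝ)) (x : M) :
    E → E [⋀^Fin 1]→L[ℝ] ℝ := fun u ↦
  ContinuousAlternatingMap.ofSubsingleton ℝ E ℝ (0 : Fin 1)
    ((η ((extChartAt 𝓘(ℝ, E) x).symm u)).comp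
      (mfderiv 𝓘(ℝ, E) 𝓘(ℝ, E) (extChartAt 𝓘(ℝ, E) x).symm u))

/-- The exterior derivative of the 1-form `η` at the point `x`: express `η` in the preferred chart
at `x`, take the exterior derivative in the model space, and pull the result back by the chart.
It depends only on the values of `η` near `x`. -/
def mextDeriv (η : (x : M) → (TangentSpace 𝓘(ℝ, E) x →L[ℝ] ℝ)) (x : M) :
    TangentSpace 𝓘(ℝ, E) x [⋀^Fin 2]→L[ℝ] ℝ :=
  ContinuousAlternatingMap.compContinuousLinearMap
    (extDeriv (oneFormInChart η x) (extChartAt 𝓘(ℝ, E) x x))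
    (mfderiv 𝓘(ℝ, E) 𝓘(ℝ, E) (extChartAt 𝓘(ℝ, E) x) x)

/-- The class of the 1-form `η` at `x`: the class of the pair `(η, dη)` at `x`, that is, the
codimension of `Ker η ∩ Ker dη` in the tangent space at `x`. -/
def formClass (η : (x : M) → (TangentSpace 𝓘(ℝ, E) x →L[ℝ] ℝ)) (x : M) : ℕ :=
  pairClass (η x) (mextDeriv η x)

end Manifold

end PrecontactClass

end

/-! Let θ be the expression of η in a chart, and consider the cone tθ on E × (0, ∞). The rank of dθ
is even, so an even class forces Ker dθ ⊆ Ker θ (`ker_le_ker_of_even_class`). Hence d(tθ) = dt ∧ θ +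
t dθ has a kernel of constant dimension dim E + 1 - 2r (`finrank_ker_cone`), on which tθ vanishes.
Let A be a smooth frame of this kernel (`exists_smooth_kernel_frame`), K the kernel at (x₀, 1), and
Ψ(z, n) the time-one value of γ' = A(γ)n, γ(0) = z. Since tθ and d(tθ) both annihilate A, the
pullback of tθ by Ψ does not see n (`exists_transverse_map`); the Frobenius theorem is not needed.

Restrict Ψ to z = (x₀ + w, 1), with w in a complement W of the projection of K to E, so that dim W =
2r - 1. The E-component of Ψ is then a local diffeomorphism W × K → E. Through its inverse, the
ℝ-component becomes g, the point x₀ + w becomes a map H, and gθ = H*θ. As H has rank at most 2r - 1,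
the class of gθ is at most 2r - 1; rescaling lowers the class by at most one
(`finrank_localCharSpace_smul_le`), so equality holds.

Smoothness of Ψ comes from the inverse function theorem in the Banach space of curves C([0, 1], F),
on which composition with a smooth map is a smooth operator (`contDiff_comp`). -/

noncomputable section

namespace PrecontactClass

/-! ### Smoothness of composition operators -/

section Nemytskii

universe u

variable {X : Type*} [TopologicalSpace X] [CompactSpace X]

/-- Pointwise application `(T, h) ↦ (s ↦ T s (h s))` as a continuous bilinear map. -/
def pointwiseApply (X : Type*) [TopologicalSpace X] [CompactSpace X]
    (F G : Type*) [NormedAddCommGroup F] [NormedSpace ℝ F] [NormedAddCommGroup G]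
    [NormedSpace ℝ G] : C(X, F →L[ℝ] G) →L[ℝ] C(X, F) →L[ℝ] C(X, G) :=
  LinearMap.mkContinuous₂
    (LinearMap.mk₂ ℝ (fun (T : C(X, F →L[ℝ] G)) (h : C(X, F)) ↦ (⟨fun s ↦ T s (h s), by fun_prop⟩ : C(X, G)))
      (fun _ _ _ ↦ by ext; simp) (fun _ _ _ ↦ by ext; simp)
      (fun _ _ _ ↦ by ext; simp) (fun _ _ _ ↦ by ext; simp)) 1
    (fun T h ↦ by
      rw [one_mul]
      refine (ContinuousMap.norm_le _ (by positivity)).2 fun s ↦ ?_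
      exact ((T s).le_opNorm (h s)).trans
        (mul_le_mul (T.norm_coe_le_norm s) (h.norm_coe_le_norm s) (norm_nonneg _) (by positivity)))

@[simp]
theorem pointwiseApply_apply {F G : Type*} [NormedAddCommGroup F] [NormedSpace ℝ F]
    [NormedAddCommGroup G] [NormedSpace ℝ G] (T : C(X, F →L[ℝ] G)) (h : C(X, F)) (s : X) :
    pointwiseApply X F G T h s = T s (h s) := rfl

/-- The mean value inequality is applied pointwise in s; compactness of X makes the modulus of
continuity of f' along γ uniform in s. -/
theorem hasFDerivAt_comp {F G : Type*} [NormedAddCommGroup F] [NormedSpace ℝ F]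
    [NormedAddCommGroup G] [NormedSpace ℝ G] (f : C(F, G)) (f' : C(F, F →L[ℝ] G))
    (hf : ∀ y, HasFDerivAt f (f' y) y) (γ : C(X, F)) :
    HasFDerivAt (fun γ : C(X, F) ↦ f.comp γ) (pointwiseApply X F G (f'.comp γ)) γ := by
  rw [hasFDerivAt_iff_isLittleO_nhds_zero, Asymptotics.isLittleO_iff]
  intro ε hε
  have hc : Filter.Tendsto (fun h : C(X, F) ↦ f'.comp (γ + h)) (𝓝 0) (𝓝 (f'.comp (γ + 0))) :=
    ((ContinuousMap.continuous_postcomp f').comp (continuous_const.add continuous_id)).tendsto 0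
  rw [add_zero] at hc
  obtain ⟨δ, hδ, hball⟩ := Metric.eventually_nhds_iff_ball.1
    (hc (Metric.ball_mem_nhds (f'.comp γ) hε))
  filter_upwards [Metric.ball_mem_nhds (0 : C(X, F)) hδ] with h hh
  refine (ContinuousMap.norm_le _ (by positivity)).2 fun s ↦ ?_
  have key : ‖f (γ s + h s) - f (γ s) - f' (γ s) (γ s + h s - γ s)‖
      ≤ ε * ‖γ s + h s - γ s‖ := by
    refine Convex.norm_image_sub_le_of_norm_hasFDerivWithin_le' (f' := f')
      (s := Metric.ball (γ s) δ) (fun y _ ↦ (hf y).hasFDerivWithinAt) (fun y hy ↦ ?_)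
      (convex_ball _ _) (Metric.mem_ball_self hδ) ?_
    · have hk : ContinuousMap.const X (y - γ s) ∈ Metric.ball (0 : C(X, F)) δ := by
        rw [mem_ball_zero_iff]
        refine (ContinuousMap.norm_lt_iff _ hδ).2 fun _ ↦ ?_
        simpa [dist_eq_norm] using hy
      have := hball _ hk
      have h2 := (ContinuousMap.dist_apply_le_dist s).trans (Metric.mem_ball.1 this).le
      simpa [dist_eq_norm] using h2
    · have := (h.norm_coe_le_norm s).trans_lt (mem_ball_zero_iff.1 hh)
      simpa [dist_eq_norm] using this
  rw [add_sub_cancel_left] at key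
  exact key.trans (mul_le_mul_of_nonneg_left (h.norm_coe_le_norm s) hε.le)

/-- The derivative is a fixed continuous linear map applied to composition with f', so induction on
n works once the target G is allowed to vary. -/
theorem contDiff_comp_nat {F : Type u} [NormedAddCommGroup F] [NormedSpace ℝ F] (n : ℕ) :
    ∀ {G : Type u} [NormedAddCommGroup G] [NormedSpace ℝ G] (f : C(F, G)),
      ContDiff ℝ n f → ContDiff ℝ n (fun γ : C(X, F) ↦ f.comp γ) := by
  induction n with
  | zero =>
    intro G _ _ f _
    exact contDiff_zero.2 (ContinuousMap.continuous_postcomp f)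
  | succ n ih =>
    intro G _ _ f hf
    rw [Nat.cast_add, Nat.cast_one, contDiff_succ_iff_hasFDerivAt] at hf ⊢
    obtain ⟨f', hf', hd⟩ := hf
    exact ⟨fun γ ↦ pointwiseApply X F G (ContinuousMap.comp ⟨f', hf'.continuous⟩ γ),
      by exact (pointwiseApply X F G).contDiff.comp (ih ⟨f', hf'.continuous⟩ hf'),
      hasFDerivAt_comp f ⟨f', hf'.continuous⟩ hd⟩

/-- Composition with a smooth map is a smooth operator on spaces of continuous maps. -/
theorem contDiff_comp {F G : Type u} [NormedAddCommGroup F] [NormedSpace ℝ F]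
    [NormedAddCommGroup G] [NormedSpace ℝ G] (f : C(F, G)) (hf : ContDiff ℝ ∞ f) :
    ContDiff ℝ ∞ (fun γ : C(X, F) ↦ f.comp γ) := by
  rw [contDiff_infty] at hf ⊢
  exact fun n ↦ contDiff_comp_nat n f (hf n)

theorem contDiff_clm_comp {F V : Type u} [NormedAddCommGroup F] [NormedSpace ℝ F]
    [NormedAddCommGroup V] [NormedSpace ℝ V] {W : Type*} [NormedAddCommGroup W] [NormedSpace ℝ W]
    (L : C(X, V) →L[ℝ] W) (f : C(F, V)) (hf : ContDiff ℝ ∞ f) :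
    ContDiff ℝ ∞ (fun γ : C(X, F) ↦ L (f.comp γ)) :=
  L.contDiff.comp (contDiff_comp f hf)

theorem hasFDerivAt_clm_comp {F V W Q : Type*} [NormedAddCommGroup F] [NormedSpace ℝ F]
    [NormedAddCommGroup V] [NormedSpace ℝ V] [NormedAddCommGroup W] [NormedSpace ℝ W]
    [NormedAddCommGroup Q] [NormedSpace ℝ Q]
    (L : C(X, V) →L[ℝ] W) (f : C(F, V)) (f' : C(F, F →L[ℝ] V))
    (hf : ∀ y, HasFDerivAt f (f' y) y) {Γ : Q → C(X, F)} {Γ' : Q →L[ℝ] C(X, F)} {q : Q}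
    (hΓ : HasFDerivAt Γ Γ' q) :
    HasFDerivAt (fun p ↦ L (f.comp (Γ p)))
      (L.comp ((pointwiseApply X F V (f'.comp (Γ q))).comp Γ')) q :=
  L.hasFDerivAt.comp q ((hasFDerivAt_comp f f' hf (Γ q)).comp q hΓ)

end Nemytskii

/-! ### The integration operator -/

section Primitive

variable {F : Type*} [NormedAddCommGroup F] [NormedSpace ℝ F]

theorem hasDerivAt_primitive [CompleteSpace F] (γ : C(unitInterval, F)) (s : ℝ) :
    HasDerivAt (fun t : ℝ ↦ ∫ σ in (0 : ℝ)..t, Set.IccExtend zero_le_one γ σ)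
      (Set.IccExtend zero_le_one γ s) s := by
  have hc : Continuous (Set.IccExtend (zero_le_one (α := ℝ)) γ) := γ.continuous.Icc_extend'
  exact intervalIntegral.integral_hasDerivAt_right (hc.intervalIntegrable _ _)
    (hc.stronglyMeasurableAtFilter _ _) hc.continuousAt

/-- The operator sending `γ` to its primitive `s ↦ ∫ σ in 0..s, γ σ`. -/
def primitive (F : Type*) [NormedAddCommGroup F] [NormedSpace ℝ F] [CompleteSpace F] :
    C(unitInterval, F) →L[ℝ] C(unitInterval, F) :=
  LinearMap.mkContinuous
    { toFun := fun γ ↦ ⟨fun s ↦ ∫ σ in (0 : ℝ)..s, Set.IccExtend zero_le_one γ σ,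
        (continuous_iff_continuousAt.2 fun s ↦ (hasDerivAt_primitive γ s).continuousAt).comp
          continuous_subtype_val⟩
      map_add' := fun γ δ ↦ by
        ext s
        have h (γ : C(unitInterval, F)) := (γ.continuous.Icc_extend'
          (h := zero_le_one (α := ℝ))).intervalIntegrable (μ := MeasureTheory.volume) 0 s
        exact intervalIntegral.integral_add (h γ) (h δ)
      map_smul' := fun c γ ↦ by
        ext s
        exact intervalIntegral.integral_smul c _ } 1
    (fun γ ↦ by
      rw [one_mul]
      refine (ContinuousMap.norm_le _ (norm_nonneg _)).2 fun s ↦ ?_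
      refine (intervalIntegral.norm_integral_le_of_norm_le_const (C := ‖γ‖)
        fun σ _ ↦ γ.norm_coe_le_norm _).trans ?_
      rw [sub_zero, abs_of_nonneg s.2.1]
      exact mul_le_of_le_one_right (norm_nonneg _) s.2.2)

theorem primitive_apply [CompleteSpace F] (γ : C(unitInterval, F)) (s : unitInterval) :
    primitive F γ s = ∫ σ in (0 : ℝ)..s, Set.IccExtend zero_le_one γ σ := rfl

end Primitive

/-! ### Smooth local inverses -/

/-- The inverse function theorem gives smoothness of the inverse only at the image of a; shrinking
the source to points where the derivative is invertible gives it on the whole target. -/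
theorem exists_smooth_localInverse {E F : Type*} [NormedAddCommGroup E] [NormedSpace ℝ E]
    [CompleteSpace E] [NormedAddCommGroup F] [NormedSpace ℝ F] {G : E → F} {U : Set E}
    (hU : IsOpen U) (hG : ContDiffOn ℝ ∞ G U) {a : E} (ha : a ∈ U) (G' : E ≃L[ℝ] F)
    (hG' : HasFDerivAt G (G' : E →L[ℝ] F) a) :
    ∃ e : OpenPartialHomeomorph E F, (e : E → F) = G ∧ a ∈ e.source ∧ e.source ⊆ U ∧
      ContDiffOn ℝ ∞ e.symm e.target := by
  have hc : ContDiffAt ℝ ∞ G a := hG.contDiffAt (hU.mem_nhds ha)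
  let e := hc.toOpenPartialHomeomorph G hG' (by simp)
  have hfd : ContinuousOn (fderiv ℝ G) U := hG.continuousOn_fderiv_of_isOpen hU (by simp)
  have hN : (U ∩ fderiv ℝ G ⁻¹' interior (Set.range
      (fun e : E ≃L[ℝ] F ↦ (e : E →L[ℝ] F)))) ∈ 𝓝 a := by
    refine Filter.inter_mem (hU.mem_nhds ha) ((hfd.continuousAt (hU.mem_nhds ha)) ?_)
    rw [hG'.fderiv]
    exact interior_mem_nhds.2 G'.nhds
  have hO := hfd.isOpen_inter_preimage hU (isOpen_interior (s := Set.range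
      (fun e : E ≃L[ℝ] F ↦ (e : E →L[ℝ] F))))
  refine ⟨e.restrOpen _ hO, hc.toOpenPartialHomeomorph_coe hG' (by simp),
    ⟨hc.mem_toOpenPartialHomeomorph_source hG' (by simp), mem_of_mem_nhds hN⟩,
    fun x hx ↦ hx.2.1, fun y hy ↦ ContDiffAt.contDiffWithinAt ?_⟩
  have hy' := (e.restrOpen _ hO).map_target hy
  obtain ⟨f', hf'⟩ := interior_subset hy'.2.2
  have hcy : ContDiffAt ℝ ∞ G ((e.restrOpen _ hO).symm y) :=
    hG.contDiffAt (hU.mem_nhds hy'.2.1)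
  refine (e.restrOpen _ hO).contDiffAt_symm (f₀' := f') hy ?_ ?_
  · change HasFDerivAt G _ _
    have : (f' : E →L[ℝ] F) = _ := hf'
    rw [this]
    exact (hcy.differentiableAt (by simp)).hasFDerivAt
  · exact hcy

/-! ### Radial flows with parameters -/

section RadialFlow

universe u

variable {F P : Type u} [NormedAddCommGroup F] [NormedSpace ℝ F] [CompleteSpace F]
  [NormedAddCommGroup P] [NormedSpace ℝ P] [CompleteSpace P]

/-- Constant curves, as a continuous linear map. -/
def constCurve (F : Type*) [NormedAddCommGroup F] [NormedSpace ℝ F] :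
    F →L[ℝ] C(unitInterval, F) :=
  LinearMap.mkContinuous
    { toFun := ContinuousMap.const unitInterval
      map_add' := fun _ _ ↦ rfl
      map_smul' := fun _ _ ↦ rfl } 1
    (fun v ↦ by
      rw [one_mul]
      exact (ContinuousMap.norm_le _ (norm_nonneg _)).2 fun _ ↦ le_rfl)

@[simp]
theorem constCurve_apply {F : Type*} [NormedAddCommGroup F] [NormedSpace ℝ F] (v : F)
    (s : unitInterval) : constCurve F v s = v := rfl

/-- The operator `n ↦ (s ↦ ∫ σ in 0..s, T σ n)` attached to a curve `T` of linear maps. -/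
def primitiveApply (F P : Type*) [NormedAddCommGroup F] [NormedSpace ℝ F] [CompleteSpace F]
    [NormedAddCommGroup P] [NormedSpace ℝ P] :
    C(unitInterval, P →L[ℝ] F) →L[ℝ] P →L[ℝ] C(unitInterval, F) :=
  ((ContinuousLinearMap.compL ℝ P C(unitInterval, F) C(unitInterval, F)) (primitive F)).comp
    (((ContinuousLinearMap.compL ℝ P C(unitInterval, P) C(unitInterval, F)).flip
      (constCurve P)).comp (pointwiseApply unitInterval P F))

theorem primitiveApply_apply {F P : Type*} [NormedAddCommGroup F] [NormedSpace ℝ F]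
    [CompleteSpace F] [NormedAddCommGroup P] [NormedSpace ℝ P] (T : C(unitInterval, P →L[ℝ] F))
    (n : P) : primitiveApply F P T n =
      primitive F (pointwiseApply unitInterval P F T (constCurve P n)) := rfl

/-- At first coordinate 0 the derivative of N contributes nothing, so the differential is triangular
and invertible without any smallness assumption. -/
theorem hasFDerivAt_shear {V Q : Type*} [NormedAddCommGroup V] [NormedSpace ℝ V]
    [NormedAddCommGroup Q] [NormedSpace ℝ Q] {N : V → Q →L[ℝ] V} {v : V}
    (hN : DifferentiableAt ℝ N v) :
    HasFDerivAt (fun p : Q × V ↦ (p.1, p.2 - N p.2 p.1))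
      (((ContinuousLinearEquiv.refl ℝ Q).skewProd (ContinuousLinearEquiv.refl ℝ V) (-(N v)) :
        (Q × V) ≃L[ℝ] (Q × V)) : (Q × V) →L[ℝ] (Q × V)) (0, v) := by
  have h1 : HasFDerivAt (fun p : Q × V ↦ N p.2)
      ((fderiv ℝ N v).comp (ContinuousLinearMap.snd ℝ Q V)) (0, v) :=
    HasFDerivAt.comp (g := N) (0, v) hN.hasFDerivAt hasFDerivAt_snd
  have h2 := h1.clm_apply (hasFDerivAt_fst (p := ((0, v) : Q × V)))
  refine ((hasFDerivAt_fst (p := ((0, v) : Q × V))).prodMk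
    ((hasFDerivAt_snd (p := ((0, v) : Q × V))).sub h2)).congr_fderiv ?_
  exact ContinuousLinearMap.ext fun v ↦ by simp [sub_eq_add_neg]

/-- Smooth dependence on `(z, n)` of the solution on `[0, 1]` of `γ' = A(γ) n`, `γ(0) = z`. -/
theorem exists_smooth_radialFlow (A : C(F, P →L[ℝ] F)) (hA : ContDiff ℝ ∞ A) (z₀ : F) {δ : ℝ}
    (hδ : 0 < δ) :
    ∃ U : Set (F × P), IsOpen U ∧ (z₀, 0) ∈ U ∧ ∃ Γ : F × P → C(unitInterval, F),
      ContDiffOn ℝ ∞ Γ U ∧ Γ (z₀, 0) = constCurve F z₀ ∧ ∀ q ∈ U,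
        Γ q = constCurve F q.1 + primitiveApply F P (A.comp (Γ q)) q.2 ∧
        ∀ s, Γ q s ∈ Metric.ball z₀ δ := by
  let N : C(unitInterval, F) → P →L[ℝ] C(unitInterval, F) :=
    fun γ ↦ primitiveApply F P (A.comp γ)
  have hN : ContDiff ℝ ∞ N := 
    contDiff_clm_comp (V := P →L[ℝ] F) (W := P →L[ℝ] C(unitInterval, F)) (primitiveApply F P) A hA
  -- Solutions of the integral equation with data (z, n) are exactly the solutions γ of G (n, γ) =
  -- (n, const z).
  let G : P × C(unitInterval, F) → P × C(unitInterval, F) := fun p ↦ (p.1, p.2 - N p.2 p.1)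
  have hG : ContDiff ℝ ∞ G :=
    contDiff_fst.prodMk (contDiff_snd.sub ((hN.comp contDiff_snd).clm_apply contDiff_fst))
  let a : P × C(unitInterval, F) := (0, constCurve F z₀)
  have hGa : G a = a := by simp [G, a]
  let G' : (P × C(unitInterval, F)) ≃L[ℝ] (P × C(unitInterval, F)) :=
    (ContinuousLinearEquiv.refl ℝ P).skewProd (ContinuousLinearEquiv.refl ℝ _)
      (-(N (constCurve F z₀)))
  have hG' : HasFDerivAt G (G' : (P × C(unitInterval, F)) →L[ℝ] (P × C(unitInterval, F))) a := by
    exact hasFDerivAt_shear (V := C(unitInterval, F)) (hN.differentiable (by simp) _)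
  obtain ⟨e, heG, hae, hes, hsm⟩ := exists_smooth_localInverse
    (isOpen_univ.prod (Metric.isOpen_ball (x := constCurve F z₀) (ε := δ))) hG.contDiffOn
    (a := a) (Set.mk_mem_prod (Set.mem_univ _) (Metric.mem_ball_self hδ)) G' hG'
  let j : F × P →L[ℝ] P × C(unitInterval, F) :=
    (ContinuousLinearMap.snd ℝ F P).prod ((constCurve F).comp (ContinuousLinearMap.fst ℝ F P))
  have hja : j (z₀, 0) = a := rfl
  have hea : e.symm a = a := by
    conv_lhs => rw [← hGa, ← heG]
    exact e.left_inv hae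
  refine ⟨j ⁻¹' e.target, e.open_target.preimage j.continuous, ?_,
    fun q ↦ (e.symm (j q)).2, ?_, ?_, fun q hq ↦ ?_⟩
  · rw [Set.mem_preimage, hja, ← hGa, ← heG]
    exact e.map_source hae
  · exact contDiff_snd.comp_contDiffOn (hsm.comp j.contDiff.contDiffOn (Set.mapsTo_preimage _ _))
  · beta_reduce
    rw [hja, hea]
  · have h1 : G (e.symm (j q)) = j q := by
      rw [← heG]
      exact e.right_inv hq
    have h2 : (e.symm (j q)).1 = q.2 := congrArg Prod.fst h1
    have h3 : (e.symm (j q)).2 - N (e.symm (j q)).2 (e.symm (j q)).1 = constCurve F q.1 :=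
      congrArg Prod.snd h1
    refine ⟨?_, fun s ↦ ?_⟩
    · rw [h2] at h3
      exact sub_eq_iff_eq_add.1 h3
    · have h4 := (hes (e.map_target hq)).2
      exact (ContinuousMap.dist_apply_le_dist s).trans_lt (Metric.mem_ball.1 h4)

/-- If the 1-form `θ` and its exterior derivative both vanish on the distribution spanned by `A`,
then the radial flow of `A` pulls `θ` back to a form independent of the radial variable. -/
theorem exists_transverse_map (A : C(F, P →L[ℝ] F)) (hA : ContDiff ℝ ∞ A) (θ : F → F →L[ℝ] ℝ)
    {O : Set F} (hO : IsOpen O) (hθ : DifferentiableOn ℝ θ O) {z₀ : F} (hz₀ : z₀ ∈ O)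
    (h1 : ∀ z ∈ O, ∀ n, θ z (A z n) = 0)
    (h2 : ∀ z ∈ O, ∀ n u, fderiv ℝ θ z (A z n) u = fderiv ℝ θ z u (A z n)) :
    ∃ U : Set (F × P), IsOpen U ∧ (z₀, 0) ∈ U ∧ ∃ Ψ : F × P → F, ContDiffOn ℝ ∞ Ψ U ∧
      Ψ (z₀, 0) = z₀ ∧ (∀ u ν, fderiv ℝ Ψ (z₀, 0) (u, ν) = u + A z₀ ν) ∧
      ∀ q ∈ U, Ψ q ∈ O ∧ ∀ u ν, θ (Ψ q) (fderiv ℝ Ψ q (u, ν)) = θ q.1 u := by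
  obtain ⟨δ, hδ, hball⟩ := Metric.isOpen_iff.1 hO z₀ hz₀
  obtain ⟨U, hU, hmem, Γ, hΓ, hΓ0, hΓU⟩ := exists_smooth_radialFlow A hA z₀ hδ
  let ev : C(unitInterval, F) →L[ℝ] F := ContinuousMap.evalCLM ℝ (1 : unitInterval)
  let A' : C(F, F →L[ℝ] P →L[ℝ] F) := ⟨fderiv ℝ A, hA.continuous_fderiv (by simp)⟩
  have hA' : ∀ y, HasFDerivAt A (A' y) y := fun y ↦
    (hA.differentiable (by simp)).differentiableAt.hasFDerivAt
  have hΓd : ∀ q ∈ U, HasFDerivAt Γ (fderiv ℝ Γ q) q := fun q hq ↦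
    ((hΓ.contDiffAt (hU.mem_nhds hq)).differentiableAt (by simp)).hasFDerivAt
  -- The linearised equation, obtained by differentiating the integral equation on the open set U.
  have hΓ' : ∀ q ∈ U, ∀ u ν, fderiv ℝ Γ q (u, ν) = constCurve F u +
      (primitiveApply F P (A.comp (Γ q)) ν +
        primitiveApply F P (pointwiseApply _ _ _ (A'.comp (Γ q)) (fderiv ℝ Γ q (u, ν))) q.2) := by
    intro q hq u ν
    have e1 := hasFDerivAt_clm_comp (V := P →L[ℝ] F)
      (W := P →L[ℝ] C(unitInterval, F)) (primitiveApply F P) A A' hA' (hΓd q hq)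
    have e2 := e1.clm_apply (hasFDerivAt_snd (p := q))
    have e3 := (((constCurve F).hasFDerivAt.comp q (hasFDerivAt_fst (p := q))).add e2)
    have e4 := e3.congr_of_eventuallyEq (f₁ := Γ)
      (Filter.eventuallyEq_of_mem (hU.mem_nhds hq) fun p hp ↦ (hΓU p hp).1)
    have e5 := congrArg (fun T ↦ T (u, ν)) ((hΓd q hq).unique e4)
    simpa using e5
  have hΨ' : ∀ q ∈ U, ∀ p, fderiv ℝ (fun q ↦ ev (Γ q)) q p = fderiv ℝ Γ q p 1 := by
    intro q hq p
    have : HasFDerivAt (fun q ↦ ev (Γ q)) (ev.comp (fderiv ℝ Γ q)) q :=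
      ev.hasFDerivAt.comp q (hΓd q hq)
    rw [this.fderiv]
    rfl
  refine ⟨U, hU, hmem, fun q ↦ ev (Γ q), ev.contDiff.comp_contDiffOn hΓ, ?_, fun u ν ↦ ?_,
    fun q hq ↦ ⟨hball ((hΓU q hq).2 1), fun u ν ↦ ?_⟩⟩
  · beta_reduce
    rw [hΓ0]
    rfl
  · rw [hΨ' _ hmem, hΓ' _ hmem, hΓ0]
    simp [primitiveApply_apply, primitive_apply, Set.IccExtend]
  · rw [hΨ' q hq]
    set γ := Γ q with hγ
    set d := fderiv ℝ Γ q (u, ν) with hd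
    -- l and k are the velocities of γ and of its variation d; γe and de extend these curves to ℝ,
    -- so two-sided derivatives exist at the endpoints too.
    let l : C(unitInterval, F) :=
      pointwiseApply _ _ _ (A.comp γ) (constCurve P q.2)
    let k : C(unitInterval, F) := pointwiseApply _ _ _ (A.comp γ) (constCurve P ν) +
      pointwiseApply _ _ _ (pointwiseApply _ _ _ (A'.comp γ) d) (constCurve P q.2)
    let γe : ℝ → F := fun s ↦ q.1 + ∫ σ in (0 : ℝ)..s, Set.IccExtend zero_le_one l σ
    let de : ℝ → F := fun s ↦ u + ∫ σ in (0 : ℝ)..s, Set.IccExtend zero_le_one k σ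
    have hγe : ∀ s : unitInterval, γe s = γ s := fun s ↦ by
      conv_rhs => rw [hγ, (hΓU q hq).1]
      rfl
    have hde : ∀ s : unitInterval, de s = d s := fun s ↦ by
      conv_rhs => rw [hd, hΓ' q hq u ν, primitiveApply_apply, primitiveApply_apply, ← map_add]
      rfl
    have hγd : ∀ s : unitInterval, HasDerivAt γe (l s) s := fun s ↦ by
      have := (hasDerivAt_primitive l s).const_add q.1
      rwa [Set.IccExtend_val] at this
    have hdd : ∀ s : unitInterval, HasDerivAt de (k s) s := fun s ↦ by
      have := (hasDerivAt_primitive k s).const_add u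
      rwa [Set.IccExtend_val] at this
    have hder : ∀ s : unitInterval, HasDerivAt (fun t ↦ θ (γe t) (de t)) 0 s := by
      intro s
      have hO' : γ s ∈ O := hball ((hΓU q hq).2 s)
      have t1 : HasFDerivAt θ (fderiv ℝ θ (γ s)) (γe s) := by
        rw [hγe]
        exact (hθ.differentiableAt (hO.mem_nhds hO')).hasFDerivAt
      have t2 := (t1.comp_hasDerivAt (s : ℝ) (hγd s)).clm_apply (hdd s)
      refine t2.congr_deriv ?_
      -- Differentiating θ(A n) = 0 along d cancels the remaining terms, once `h2` has exchanged the
      -- two arguments of the derivative of θ.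
      have t3 : HasFDerivAt (fun z ↦ θ z (A z q.2)) _ (γ s) :=
        (hθ.differentiableAt (hO.mem_nhds hO')).hasFDerivAt.clm_apply
          ((hA' (γ s)).clm_apply (hasFDerivAt_const q.2 (γ s)))
      have t4 : HasFDerivAt (fun z ↦ θ z (A z q.2)) (0 : F →L[ℝ] ℝ) (γ s) :=
        (hasFDerivAt_const (0 : ℝ) (γ s)).congr_of_eventuallyEq
          (Filter.eventuallyEq_of_mem (hO.mem_nhds hO') fun z hz ↦ h1 z hz q.2)
      have t5 := congrArg (fun T ↦ T (d s)) (t3.unique t4)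
      have t6 := h2 (γ s) hO' q.2 (d s)
      have t7 := h1 (γ s) hO' ν
      simp only [add_apply, ContinuousLinearMap.comp_apply,
        ContinuousLinearMap.flip_apply, zero_apply, map_zero,
        zero_add] at t5
      simp only [Function.comp_apply, hγe, hde]
      simp only [l, k, ContinuousMap.add_apply, pointwiseApply_apply, ContinuousMap.comp_apply,
        constCurve_apply, map_add]
      rw [t6, t7, zero_add, add_comm]
      simpa using t5
    have hconst := constant_of_has_deriv_right_zero (f := fun t ↦ θ (γe t) (de t)) (a := 0) (b := 1)
      (fun t ht ↦ (hder ⟨t, ht⟩).continuousAt.continuousWithinAt)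
      (fun t ht ↦ (hder ⟨t, ht.1, ht.2.le⟩).hasDerivWithinAt) 1 ⟨zero_le_one, le_rfl⟩
    have s1 : γe 1 = γ 1 := hγe 1
    have s2 : de 1 = d 1 := hde 1
    have s3 : γe 0 = q.1 := by simp [γe]
    have s4 : de 0 = u := by simp [de]
    simp only [s1, s2, s3, s4] at hconst
    exact hconst

end RadialFlow

/-! ### Linear algebra of alternating forms -/

section AlternatingForms

open Module

variable {T : Type*} [AddCommGroup T] [Module ℝ T] [FiniteDimensional ℝ T]

/-- A skew matrix of odd size has determinant zero. -/
theorem even_finrank_of_separatingLeft {β : T →ₗ[ℝ] T →ₗ[ℝ] ℝ} (hβ : β.IsAlt)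
    (hs : β.SeparatingLeft) : Even (finrank ℝ T) := by
  classical
  let b := finBasis ℝ T
  have hdet := (LinearMap.separatingLeft_iff_det_ne_zero b).1 hs
  set S := LinearMap.toMatrix₂ b b β with hS
  have hskew : S.transpose = -S := by
    ext i j
    rw [Matrix.transpose_apply, Matrix.neg_apply, hS, LinearMap.toMatrix₂_apply,
      LinearMap.toMatrix₂_apply, hβ.neg]
  by_contra hodd
  rw [Nat.not_even_iff_odd] at hodd
  have h1 : S.det = -S.det := by
    conv_lhs => rw [← Matrix.det_transpose, hskew, Matrix.det_neg, Fintype.card_fin,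
      hodd.neg_one_pow, neg_one_mul]
  exact hdet (by linarith)

/-- The form is nondegenerate on any complement of its kernel, and the rank is the dimension of that
complement. -/
theorem even_finrank_range {β : T →ₗ[ℝ] T →ₗ[ℝ] ℝ} (hβ : β.IsAlt) :
    Even (finrank ℝ (LinearMap.range β)) := by
  obtain ⟨C, hC⟩ := Submodule.exists_isCompl (LinearMap.ker β)
  have h1 := LinearMap.finrank_range_add_finrank_ker β
  have h2 := Submodule.finrank_add_eq_of_isCompl hC
  have h3 : finrank ℝ (LinearMap.range β) = finrank ℝ C := by omega
  rw [h3]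
  refine even_finrank_of_separatingLeft (β := β.domRestrict₁₂ C C) (fun x ↦ hβ x) fun c hc ↦ ?_
  have hker : (c : T) ∈ LinearMap.ker β := by
    rw [LinearMap.mem_ker]
    ext u
    have hu : u ∈ LinearMap.ker β ⊔ C := by rw [hC.sup_eq_top]; trivial
    obtain ⟨k, hk, d, hd, rfl⟩ := Submodule.mem_sup.1 hu
    have e1 : β c d = 0 := hc ⟨d, hd⟩
    have e2 : β c k = 0 := by
      rw [← hβ.neg, LinearMap.mem_ker.1 hk, LinearMap.zero_apply, neg_zero]
    simp [e1, e2]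
  exact Subtype.ext (Submodule.disjoint_def.1 hC.disjoint _ hker c.2)

/-- If τ were nonzero on Ker β, the class would be rank β + 1, which is odd. -/
theorem ker_le_ker_of_even_class {τ : T →ₗ[ℝ] ℝ} {β : T →ₗ[ℝ] T →ₗ[ℝ] ℝ} (hβ : β.IsAlt) {r : ℕ}
    (h : finrank ℝ (T ⧸ (LinearMap.ker τ ⊓ LinearMap.ker β)) = 2 * r) :
    LinearMap.ker β ≤ LinearMap.ker τ := by
  by_contra hle
  have hne : τ.domRestrict (LinearMap.ker β) ≠ 0 := fun h0 ↦ hle fun v hv ↦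
    LinearMap.congr_fun h0 ⟨v, hv⟩
  have h1 := Dual.finrank_ker_add_one_of_ne_zero hne
  have h2 : finrank ℝ (LinearMap.ker (τ.domRestrict (LinearMap.ker β))) =
      finrank ℝ (LinearMap.ker τ ⊓ LinearMap.ker β : Submodule ℝ T) := by
    rw [LinearMap.ker_domRestrict, inf_comm]
    rw [← Submodule.finrank_map_subtype_eq, Submodule.map_comap_subtype]
  have h3 := LinearMap.finrank_range_add_finrank_ker β
  have h4 := Submodule.finrank_quotient_add_finrank (LinearMap.ker τ ⊓ LinearMap.ker β)
  obtain ⟨k, hk⟩ := even_finrank_range hβ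
  omega

/-- By a dimension count, the range of β is the full annihilator of its kernel. -/
theorem exists_apply_eq_of_ker_le {τ : T →ₗ[ℝ] ℝ} {β : T →ₗ[ℝ] T →ₗ[ℝ] ℝ} (hβ : β.IsAlt)
    (h : LinearMap.ker β ≤ LinearMap.ker τ) : ∃ v, β v = τ := by
  have hle : LinearMap.range β ≤ (LinearMap.ker β).dualAnnihilator := by
    rintro _ ⟨v, rfl⟩
    rw [Submodule.mem_dualAnnihilator]
    intro k hk
    rw [← hβ.neg, LinearMap.mem_ker.1 hk, LinearMap.zero_apply, neg_zero]
  have h1 := Subspace.finrank_add_finrank_dualAnnihilator_eq (LinearMap.ker β)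
  have h2 := LinearMap.finrank_range_add_finrank_ker β
  have heq := Submodule.eq_of_le_of_finrank_eq hle
    (Nat.add_right_cancel (h2.trans ((add_comm _ _).trans h1).symm))
  have : τ ∈ LinearMap.range β := by
    rw [heq, Submodule.mem_dualAnnihilator]
    exact fun k hk ↦ h hk
  exact this

/-- The kernel of the form `dt ∧ τ + t β` on `T × ℝ` has one dimension more than that of `β`. -/
theorem finrank_ker_cone {τ : T →ₗ[ℝ] ℝ} {β : T →ₗ[ℝ] T →ₗ[ℝ] ℝ} (hβ : β.IsAlt)
    (h : LinearMap.ker β ≤ LinearMap.ker τ) {t : ℝ} (ht : t ≠ 0)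
    {Ω : T × ℝ →ₗ[ℝ] T × ℝ →ₗ[ℝ] ℝ}
    (hΩ : ∀ w a u b, Ω (w, a) (u, b) = a * τ u - b * τ w + t * β w u) :
    finrank ℝ (LinearMap.ker Ω) = finrank ℝ (LinearMap.ker β) + 1 := by
  obtain ⟨v, hv⟩ := exists_apply_eq_of_ker_le hβ h
  have hτv : τ v = 0 := by rw [← hv]; exact hβ v
  -- With β v = τ, the vector (v, -t) lies in the kernel and generates it together with Ker β × 0.
  let f : (LinearMap.ker β) × ℝ →ₗ[ℝ] T × ℝ :=
    ((LinearMap.ker β).subtype.coprod (LinearMap.toSpanSingleton ℝ T v)).prod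
      ((-t) • LinearMap.snd ℝ _ ℝ)
  have hf : ∀ k c, f (k, c) = ((k : T) + c • v, -t * c) := fun k c ↦ by simp [f]
  have hinj : Function.Injective f := by
    rw [injective_iff_map_eq_zero]
    rintro ⟨k, c⟩ hkc
    rw [hf, Prod.mk_eq_zero] at hkc
    have hc : c = 0 := by
      rcases mul_eq_zero.1 hkc.2 with h' | h'
      · exact absurd (neg_eq_zero.1 h') ht
      · exact h'
    have hk := hkc.1
    rw [hc, zero_smul, add_zero] at hk
    rw [hc, Submodule.coe_eq_zero.1 hk]
    rfl
  have hrange : LinearMap.range f = LinearMap.ker Ω := by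
    apply le_antisymm
    · rintro _ ⟨⟨k, c⟩, rfl⟩
      rw [LinearMap.mem_ker]
      ext1
      · ext u
        have e1 : β k = 0 := k.2
        simp [hf, hΩ, hv, e1]
        ring
      · ext
        have e1 : τ k = 0 := h k.2
        simp [hf, hΩ, hτv, e1]
    · rintro ⟨w, a⟩ hwa
      have hz : ∀ u b, a * τ u - b * τ w + t * β w u = 0 := fun u b ↦ by
        rw [← hΩ, LinearMap.mem_ker.1 hwa]; rfl
      have hw : τ w = 0 := by simpa using hz 0 1
      have hk : w + (a / t) • v ∈ LinearMap.ker β := by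
        rw [LinearMap.mem_ker]
        ext u
        have := hz u 0
        simp only [map_add, map_smul, hv, LinearMap.add_apply, LinearMap.smul_apply, smul_eq_mul,
          LinearMap.zero_apply]
        field_simp
        linarith
      refine ⟨(⟨_, hk⟩, -(a / t)), ?_⟩
      rw [hf]
      ext
      · simp
      · simp only
        field_simp
  rw [← hrange, LinearMap.finrank_range_of_inj hinj, finrank_prod, finrank_self]

end AlternatingForms

/-! ### Smooth frames of kernels of constant dimension -/

section KernelFrame

open Module

theorem exists_comp_eq_of_ker_le {K V V' V'' : Type*} [Field K] [AddCommGroup V] [Module K V]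
    [AddCommGroup V'] [Module K V'] [AddCommGroup V''] [Module K V''] (f : V →ₗ[K] V')
    (g : V →ₗ[K] V'') (h : LinearMap.ker f ≤ LinearMap.ker g) :
    ∃ q : V' →ₗ[K] V'', q ∘ₗ f = g := by
  obtain ⟨q, hq⟩ := LinearMap.exists_extend
    ((LinearMap.ker f).liftQ g h ∘ₗ f.quotKerEquivRange.symm.toLinearMap)
  refine ⟨q, LinearMap.ext fun v ↦ ?_⟩
  have h1 := LinearMap.congr_fun hq ⟨f v, v, rfl⟩
  simp only [LinearMap.comp_apply, Submodule.subtype_apply, LinearEquiv.coe_coe] at h1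
  rw [LinearMap.comp_apply, h1]
  have h2 : f.quotKerEquivRange.symm ⟨f v, v, rfl⟩ = (LinearMap.ker f).mkQ v := by
    rw [LinearEquiv.symm_apply_eq]
    rfl
  rw [h2, Submodule.mkQ_apply, Submodule.liftQ_apply]

/-- Multiply by a bump function. This makes the kernel frame globally smooth, as the composition
operators on curves require. -/
theorem exists_smooth_extension {X V : Type*} [NormedAddCommGroup X] [NormedSpace ℝ X]
    [FiniteDimensional ℝ X] [NormedAddCommGroup V] [NormedSpace ℝ V] {f : X → V} {O : Set X}
    (hO : IsOpen O) (hf : ContDiffOn ℝ ∞ f O) {x : X} (hx : x ∈ O) :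
    ∃ g : X → V, ContDiff ℝ ∞ g ∧ g =ᶠ[𝓝 x] f := by
  obtain ⟨ε, hε, hball⟩ := Metric.isOpen_iff.1 hO x hx
  let χ : ContDiffBump x := ⟨ε / 4, ε / 2, by positivity, by linarith⟩
  refine ⟨fun y ↦ χ y • f y, contDiff_iff_contDiffAt.2 fun y ↦ ?_, ?_⟩
  · by_cases hy : y ∈ O
    · exact χ.contDiff.contDiffAt.smul (hf.contDiffAt (hO.mem_nhds hy))
    · have hyt : y ∉ tsupport χ := fun h ↦ hy (hball (by
        rw [χ.tsupport_eq] at h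
        exact Metric.closedBall_subset_ball (by simp only [χ]; linarith) h))
      refine (contDiffAt_const (c := (0 : V))).congr_of_eventuallyEq ?_
      filter_upwards [notMem_tsupport_iff_eventuallyEq.1 hyt] with z hz
      simp [hz]
  · filter_upwards [χ.eventuallyEq_one] with y hy
    simp [hy]

/-- Choose a projection p onto K and Q with Q ∘ L(z₀) = 1 - p, and set B(z) = Q ∘ L(z) + p. Then
B(z₀) = 1, and on Ker L(z) the map B(z) is just p. Near z₀ it is invertible, so by equality of
dimensions B(z)⁻¹ carries K onto Ker L(z). -/
theorem exists_smooth_kernel_frame {X V V' : Type*} [NormedAddCommGroup X] [NormedSpace ℝ X]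
    [FiniteDimensional ℝ X] [NormedAddCommGroup V] [NormedSpace ℝ V] [FiniteDimensional ℝ V]
    [NormedAddCommGroup V'] [NormedSpace ℝ V'] [FiniteDimensional ℝ V'] {O : Set X}
    (hO : IsOpen O) {L : X → V →L[ℝ] V'} (hL : ContDiffOn ℝ ∞ L O) {z₀ : X} (hz₀ : z₀ ∈ O)
    (hker : ∀ z ∈ O, finrank ℝ (LinearMap.ker (L z).toLinearMap) =
      finrank ℝ (LinearMap.ker (L z₀).toLinearMap)) :
    ∃ A : X → LinearMap.ker (L z₀).toLinearMap →L[ℝ] V, ContDiff ℝ ∞ A ∧ (∀ n, A z₀ n = n) ∧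
      ∃ O' ⊆ O, IsOpen O' ∧ z₀ ∈ O' ∧ ∀ z ∈ O', ∀ n, L z (A z n) = 0 := by
  set K := LinearMap.ker (L z₀).toLinearMap with hK
  obtain ⟨π, hπ⟩ := LinearMap.exists_leftInverse_of_injective K.subtype K.ker_subtype
  have hπ' : ∀ k : K, π k = k := fun k ↦ LinearMap.congr_fun hπ k
  obtain ⟨Q, hQ⟩ := exists_comp_eq_of_ker_le (L z₀).toLinearMap
    (LinearMap.id - K.subtype ∘ₗ π) (fun v hv ↦ by
      have := hπ' ⟨v, hv⟩
      rw [LinearMap.mem_ker, LinearMap.sub_apply, LinearMap.comp_apply, this]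
      simp)
  have hQ' : ∀ v, Q (L z₀ v) = v - π v := fun v ↦ LinearMap.congr_fun hQ v
  let Qc : V' →L[ℝ] V := LinearMap.toContinuousLinearMap Q
  let p : V →L[ℝ] V := LinearMap.toContinuousLinearMap (K.subtype ∘ₗ π)
  let B : X → V →L[ℝ] V := fun z ↦ Qc.comp (L z) + p
  have hBapp : ∀ z v, B z v = Q (L z v) + π v := fun _ _ ↦ rfl
  have hB : ContDiffOn ℝ ∞ B O := (contDiffOn_const.clm_comp hL).add contDiffOn_const
  have hB0 : B z₀ = ContinuousLinearMap.id ℝ V :=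
    ContinuousLinearMap.ext fun v ↦ by rw [hBapp, hQ']; simp
  let R : Set (V →L[ℝ] V) :=
    interior (Set.range (fun e : V ≃L[ℝ] V ↦ (e : V →L[ℝ] V)))
  let O₁ := O ∩ B ⁻¹' R
  have hO₁ : IsOpen O₁ := hB.continuousOn.isOpen_inter_preimage hO isOpen_interior
  have hz₁ : z₀ ∈ O₁ := by
    refine ⟨hz₀, mem_interior_iff_mem_nhds.2 ?_⟩
    rw [hB0]
    exact (ContinuousLinearEquiv.refl ℝ V).nhds
  let A₁ : X → K →L[ℝ] V := fun z ↦ (ContinuousLinearMap.inverse (B z)).comp K.subtypeL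
  have hA₁ : ContDiffOn ℝ ∞ A₁ O₁ := by
    intro z hz
    obtain ⟨e, he⟩ := interior_subset hz.2
    have h1 : ContDiffAt ℝ ∞ ContinuousLinearMap.inverse (B z) := by
      rw [← he]
      exact contDiffAt_map_inverse e
    exact ((h1.comp z (hB.contDiffAt (hO.mem_nhds hz.1))).clm_comp
      contDiffAt_const).contDiffWithinAt
  obtain ⟨A, hA, hAeq⟩ := exists_smooth_extension hO₁ hA₁ hz₁
  obtain ⟨O', hO'sub, hO', hz'⟩ := mem_nhds_iff.1 (Filter.inter_mem hAeq (hO₁.mem_nhds hz₁))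
  refine ⟨A, hA, fun n ↦ ?_, O', fun z hz ↦ (hO'sub hz).2.1, hO', hz', fun z hz n ↦ ?_⟩
  · have : A z₀ = A₁ z₀ := hAeq.self_of_nhds
    rw [this]
    simp [A₁, hB0]
  · have hAz : A z = A₁ z := (hO'sub hz).1
    obtain ⟨e, he⟩ := interior_subset (hO'sub hz).2.2
    have he' : ∀ v, e v = B z v := fun v ↦ by
      rw [← he]
      rfl
    let f : LinearMap.ker (L z).toLinearMap →ₗ[ℝ] K :=
      π ∘ₗ (LinearMap.ker (L z).toLinearMap).subtype
    have hf : ∀ k : LinearMap.ker (L z).toLinearMap, e k = f k := fun k ↦ by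
      have hk : L z k = 0 := k.2
      rw [he', hBapp, hk, map_zero, zero_add]
      rfl
    have hinj : Function.Injective f := fun k k' hkk ↦
      Subtype.ext (e.injective (by rw [hf, hf, hkk]))
    obtain ⟨k, hk⟩ := (LinearMap.injective_iff_surjective_of_finrank_eq_finrank
      (hker z (hO'sub hz).2.1)).1 hinj n
    have h1 : A₁ z n = k := by
      have : B z = e := he.symm
      simp only [A₁, this, ContinuousLinearMap.inverse_equiv]
      change e.symm n = k
      rw [ContinuousLinearEquiv.symm_apply_eq, hf, hk]
    rw [hAz, h1]
    exact k.2

end KernelFrame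

/-! ### 1-forms on open subsets of a vector space -/

section LocalForms

open Module

universe u

variable {E : Type u} [NormedAddCommGroup E] [NormedSpace ℝ E]

/-- The exterior derivative of `θ` at `y` as a bilinear form. -/
def curl (θ : E → E →L[ℝ] ℝ) (y : E) : E →ₗ[ℝ] E →ₗ[ℝ] ℝ :=
  (ContinuousLinearMap.coeLM ℝ).comp (fderiv ℝ θ y - (fderiv ℝ θ y).flip).toLinearMap

theorem curl_apply (θ : E → E →L[ℝ] ℝ) (y v w : E) :
    curl θ y v w = fderiv ℝ θ y v w - fderiv ℝ θ y w v := rfl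

theorem curl_isAlt (θ : E → E →L[ℝ] ℝ) (y : E) : (curl θ y).IsAlt := fun v ↦ by
  rw [curl_apply, sub_self]

/-- The characteristic space of `θ` at `y`. -/
def localCharSpace (θ : E → E →L[ℝ] ℝ) (y : E) : Submodule ℝ E :=
  LinearMap.ker (θ y).toLinearMap ⊓ LinearMap.ker (curl θ y)

theorem mem_localCharSpace {θ : E → E →L[ℝ] ℝ} {y v : E} :
    v ∈ localCharSpace θ y ↔ θ y v = 0 ∧ ∀ w, curl θ y v w = 0 := by
  rw [localCharSpace, Submodule.mem_inf, LinearMap.mem_ker, LinearMap.mem_ker, LinearMap.ext_iff]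
  rfl

theorem localCharSpace_congr {θ θ' : E → E →L[ℝ] ℝ} {y : E} (h : θ =ᶠ[𝓝 y] θ') :
    localCharSpace θ y = localCharSpace θ' y := by
  rw [localCharSpace, localCharSpace, curl, curl, h.self_of_nhds, h.fderiv_eq]

/-- Symmetry of the second derivative of H cancels the second-order terms. -/
theorem curl_pullback {F : Type*} [NormedAddCommGroup F] [NormedSpace ℝ F] {σ : F → F →L[ℝ] ℝ}
    {H : E → F} {y : E} (hσ : DifferentiableAt ℝ σ (H y)) (hH : ContDiffAt ℝ ∞ H y) (v w : E) :
    curl (fun x ↦ (σ (H x)).comp (fderiv ℝ H x)) y v w =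
      fderiv ℝ σ (H y) (fderiv ℝ H y v) (fderiv ℝ H y w) -
        fderiv ℝ σ (H y) (fderiv ℝ H y w) (fderiv ℝ H y v) := by
  have h1 : HasFDerivAt H (fderiv ℝ H y) y := (hH.differentiableAt (by simp)).hasFDerivAt
  have h2 : HasFDerivAt (fderiv ℝ H) (fderiv ℝ (fderiv ℝ H) y) y :=
    ((hH.fderiv_right (m := 1) (by norm_cast)).differentiableAt (by simp)).hasFDerivAt
  have h3 := (hσ.hasFDerivAt.comp y h1).clm_comp h2
  have h4 := hH.isSymmSndFDerivAt (by simp; norm_cast) v w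
  rw [curl_apply]
  have h5 : fderiv ℝ (fun x ↦ (σ (H x)).comp (fderiv ℝ H x)) y = _ := h3.fderiv
  rw [h5]
  simp [h4]

theorem ker_fderiv_le_localCharSpace {F : Type*} [NormedAddCommGroup F] [NormedSpace ℝ F]
    {σ : F → F →L[ℝ] ℝ} {H : E → F} {y : E} (hσ : DifferentiableAt ℝ σ (H y))
    (hH : ContDiffAt ℝ ∞ H y) :
    LinearMap.ker (fderiv ℝ H y).toLinearMap ≤
      localCharSpace (fun x ↦ (σ (H x)).comp (fderiv ℝ H x)) y := by
  intro v hv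
  have hv' : fderiv ℝ H y v = 0 := hv
  rw [mem_localCharSpace]
  refine ⟨by simp [hv'], fun w ↦ ?_⟩
  rw [curl_pullback hσ hH, hv']
  simp

theorem curl_smul {θ : E → E →L[ℝ] ℝ} {g : E → ℝ} {y : E} (hθ : DifferentiableAt ℝ θ y)
    (hg : DifferentiableAt ℝ g y) (v w : E) :
    curl (fun x ↦ g x • θ x) y v w =
      fderiv ℝ g y v * θ y w - fderiv ℝ g y w * θ y v + g y * curl θ y v w := by
  rw [curl_apply, curl_apply]
  have : fderiv ℝ (fun x ↦ g x • θ x) y = _ := (hg.hasFDerivAt.smul hθ.hasFDerivAt).fderiv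
  rw [this]
  simp
  ring

/-- Characteristic vectors of gθ killed by dg are characteristic for θ, and dg cuts the dimension by
at most one. -/
theorem finrank_localCharSpace_smul_le [FiniteDimensional ℝ E] {θ : E → E →L[ℝ] ℝ} {g : E → ℝ} {y : E}
    (hθ : DifferentiableAt ℝ θ y) (hg : DifferentiableAt ℝ g y) (hgy : g y ≠ 0) :
    finrank ℝ (localCharSpace (fun x ↦ g x • θ x) y) ≤ finrank ℝ (localCharSpace θ y) + 1 := by
  set S := localCharSpace (fun x ↦ g x • θ x) y
  let f : S →ₗ[ℝ] ℝ := (fderiv ℝ g y).toLinearMap.domRestrict S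
  have h1 := LinearMap.finrank_range_add_finrank_ker f
  have h2 : finrank ℝ (LinearMap.range f) ≤ 1 :=
    (Submodule.finrank_le _).trans (finrank_self ℝ).le
  have h3 : (LinearMap.ker f).map S.subtype ≤ localCharSpace θ y := by
    rintro _ ⟨v, hv, rfl⟩
    have hv' : fderiv ℝ g y v = 0 := hv
    obtain ⟨e1, e2⟩ := mem_localCharSpace.1 v.2
    have e3 : θ y v = 0 := (mul_eq_zero.1 (show g y * θ y v = 0 from e1)).resolve_left hgy
    refine mem_localCharSpace.2 ⟨e3, fun w ↦ ?_⟩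
    have e4 := e2 w
    rw [curl_smul hθ hg, hv', e3] at e4
    simpa [hgy] using e4
  have h4 := Submodule.finrank_mono h3
  rw [Submodule.finrank_map_subtype_eq] at h4
  omega

/-- The cone `t θ` of a 1-form `θ`, a 1-form on `E × ℝ`. -/
def coneForm (θ : E → E →L[ℝ] ℝ) (z : E × ℝ) : E × ℝ →L[ℝ] ℝ :=
  z.2 • (θ z.1).comp (ContinuousLinearMap.fst ℝ E ℝ)

theorem coneForm_apply (θ : E → E →L[ℝ] ℝ) (z p : E × ℝ) :
    coneForm θ z p = z.2 * θ z.1 p.1 := rfl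

theorem contDiffOn_coneForm {θ : E → E →L[ℝ] ℝ} {U : Set E} (hθ : ContDiffOn ℝ ∞ θ U) :
    ContDiffOn ℝ ∞ (coneForm θ) (U ×ˢ Set.Ioi 0) :=
  contDiff_snd.contDiffOn.smul
    ((hθ.comp contDiff_fst.contDiffOn fun _ h ↦ h.1).clm_comp contDiffOn_const)

theorem fderiv_coneForm {θ : E → E →L[ℝ] ℝ} {z : E × ℝ} (hθ : DifferentiableAt ℝ θ z.1)
    (w u : E) (a b : ℝ) :
    fderiv ℝ (coneForm θ) z (w, a) (u, b) = a * θ z.1 u + z.2 * fderiv ℝ θ z.1 w u := by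
  have h1 : HasFDerivAt (fun z : E × ℝ ↦ θ z.1)
      ((fderiv ℝ θ z.1).comp (ContinuousLinearMap.fst ℝ E ℝ)) z :=
    HasFDerivAt.comp (g := θ) z hθ.hasFDerivAt hasFDerivAt_fst
  have h2 := (hasFDerivAt_snd (𝕜 := ℝ) (p := z)).smul
    (h1.clm_comp (hasFDerivAt_const (ContinuousLinearMap.fst ℝ E ℝ) z))
  have h3 : fderiv ℝ (coneForm θ) z = _ := h2.fderiv
  rw [h3]
  simp
  ring

theorem curl_coneForm {θ : E → E →L[ℝ] ℝ} {z : E × ℝ} (hθ : DifferentiableAt ℝ θ z.1)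
    (w : E) (a : ℝ) (u : E) (b : ℝ) :
    curl (coneForm θ) z (w, a) (u, b) =
      a * (θ z.1).toLinearMap u - b * (θ z.1).toLinearMap w + z.2 * curl θ z.1 w u := by
  rw [curl_apply, curl_apply, fderiv_coneForm hθ, fderiv_coneForm hθ]
  simp only [ContinuousLinearMap.coe_coe]
  ring

theorem contDiffOn_fderiv_sub_flip {F : Type*} [NormedAddCommGroup F] [NormedSpace ℝ F]
    {Θ : F → F →L[ℝ] ℝ} {O : Set F} (hO : IsOpen O) (hΘ : ContDiffOn ℝ ∞ Θ O) :
    ContDiffOn ℝ ∞ (fun z ↦ fderiv ℝ Θ z - (fderiv ℝ Θ z).flip) O := by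
  have h := hΘ.fderiv_of_isOpen hO (m := ∞) (by simp)
  have hflip : ContDiff ℝ ∞ (fun T : F →L[ℝ] F →L[ℝ] ℝ ↦ T.flip) :=
    IsBoundedLinearMap.contDiff ⟨⟨fun _ _ ↦ rfl, fun _ _ ↦ rfl⟩, 1, one_pos,
      fun T ↦ by rw [ContinuousLinearMap.opNorm_flip, one_mul]⟩
  exact h.sub (hflip.comp_contDiffOn h)

/-- A nowhere vanishing 1-form of constant class `2r` can locally be rescaled to class
`2r - 1`. -/
theorem exists_local_rescaling [FiniteDimensional ℝ E] {θ : E → E →L[ℝ] ℝ} {U : Set E}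
    (hU : IsOpen U) (hθ : ContDiffOn ℝ ∞ θ U) (hne : ∀ y ∈ U, θ y ≠ 0) {r : ℕ}
    (hclass : ∀ y ∈ U, finrank ℝ (E ⧸ localCharSpace θ y) = 2 * r) {x₀ : E} (hx₀ : x₀ ∈ U) :
    ∃ V ⊆ U, IsOpen V ∧ x₀ ∈ V ∧ ∃ g : E → ℝ, ContDiffOn ℝ ∞ g V ∧ (∀ y ∈ V, g y ≠ 0) ∧
      ∀ y ∈ V, finrank ℝ (E ⧸ localCharSpace (fun x ↦ g x • θ x) y) = 2 * r - 1 := by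
  have hθd : ∀ y ∈ U, DifferentiableAt ℝ θ y := fun y hy ↦
    (hθ.contDiffAt (hU.mem_nhds hy)).differentiableAt (by simp)
  have hkerle : ∀ y ∈ U, LinearMap.ker (curl θ y) ≤ LinearMap.ker (θ y).toLinearMap :=
    fun y hy ↦ ker_le_ker_of_even_class (curl_isAlt θ y) (hclass y hy)
  have hchar : ∀ y ∈ U, localCharSpace θ y = LinearMap.ker (curl θ y) := fun y hy ↦
    inf_eq_right.2 (hkerle y hy)
  have hdim : ∀ y ∈ U, finrank ℝ (localCharSpace θ y) + 2 * r = finrank ℝ E := fun y hy ↦ by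
    have := Submodule.finrank_quotient_add_finrank (localCharSpace θ y)
    rw [hclass y hy] at this
    omega
  -- Nonvanishing of θ excludes r = 0, so the natural-number subtraction 2r - 1 is genuine.
  have hr : 0 < r := by
    by_contra h0
    have h1 := hdim x₀ hx₀
    have h2 : localCharSpace θ x₀ = ⊤ := Submodule.eq_top_of_finrank_eq (by omega)
    refine hne x₀ hx₀ (ContinuousLinearMap.ext fun v ↦ ?_)
    exact (mem_localCharSpace.1 (show v ∈ localCharSpace θ x₀ by rw [h2]; trivial)).1
  -- the cone over `θ` and a frame of the kernel of its exterior derivative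
  let O : Set (E × ℝ) := U ×ˢ Set.Ioi 0
  have hO : IsOpen O := hU.prod isOpen_Ioi
  let z₀ : E × ℝ := (x₀, 1)
  have hz₀ : z₀ ∈ O := ⟨hx₀, show (0 : ℝ) < 1 from zero_lt_one⟩
  have hΘ : ContDiffOn ℝ ∞ (coneForm θ) O := contDiffOn_coneForm hθ
  let L : E × ℝ → E × ℝ →L[ℝ] E × ℝ →L[ℝ] ℝ :=
    fun z ↦ fderiv ℝ (coneForm θ) z - (fderiv ℝ (coneForm θ) z).flip
  have hL : ∀ z p q, L z p q = curl (coneForm θ) z p q := fun _ _ _ ↦ rfl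
  have hLker : ∀ z, LinearMap.ker (L z).toLinearMap = LinearMap.ker (curl (coneForm θ) z) := by
    intro z
    ext p
    rw [LinearMap.mem_ker, LinearMap.mem_ker, LinearMap.ext_iff, ContinuousLinearMap.coe_coe,
      ContinuousLinearMap.ext_iff]
    rfl
  have hcone : ∀ z ∈ O, finrank ℝ (LinearMap.ker (L z).toLinearMap) + 2 * r =
      finrank ℝ E + 1 := by
    intro z hz
    rw [hLker, finrank_ker_cone (curl_isAlt θ z.1) (hkerle _ hz.1) (ne_of_gt hz.2)
      (curl_coneForm (hθd _ hz.1)), ← hchar _ hz.1, ← hdim _ hz.1]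
    ring
  let K := LinearMap.ker (L z₀).toLinearMap
  obtain ⟨A, hA, hA0, O', hO'O, hO', hz₀', hLA⟩ := exists_smooth_kernel_frame (L := L) hO
    (contDiffOn_fderiv_sub_flip hO hΘ) hz₀ (fun z hz ↦ by
      have h1 := hcone z hz
      have h2 := hcone z₀ hz₀
      exact Nat.add_right_cancel (h1.trans h2.symm))
  have hcurlA : ∀ z ∈ O', ∀ n q, curl (coneForm θ) z (A z n) q = 0 := fun z hz n q ↦ by
    rw [← hL]
    exact congrArg (fun T ↦ T q) (hLA z hz n)
  obtain ⟨U₂, hU₂, hmem₂, Ψ, hΨ, hΨ0, hΨ', hΨU⟩ := exists_transverse_map ⟨A, hA.continuous⟩ hA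
    (coneForm θ) hO' ((hΘ.mono hO'O).differentiableOn (by simp)) hz₀'
    (fun z hz n ↦ by
      -- Pairing a kernel vector with ∂/∂t shows that θ vanishes on its E-component.
      have h1 := hcurlA z hz n (0, 1)
      rw [show A z n = ((A z n).1, (A z n).2) from rfl,
        curl_coneForm (hθd _ (hO'O hz).1)] at h1
      have h2 : θ z.1 (A z n).1 = 0 := by simpa using h1
      change coneForm θ z (A z n) = 0
      rw [coneForm_apply, h2, mul_zero])
    (fun z hz n u ↦ sub_eq_zero.1 (hcurlA z hz n u))
  -- a slice transverse to the kernel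
  have hdimK : finrank ℝ K + 2 * r = finrank ℝ E + 1 := hcone z₀ hz₀
  let ρ : K →ₗ[ℝ] E := LinearMap.fst ℝ E ℝ ∘ₗ K.subtype
  -- The kernel contains no nonzero vertical vector, since contracting d(tθ) with ∂/∂t gives θ ≠ 0.
  have hρ : Function.Injective ρ := by
    rw [injective_iff_map_eq_zero]
    rintro ⟨⟨w, a⟩, hwa⟩ h0
    have hw : w = 0 := h0
    subst hw
    obtain ⟨u, hu⟩ : ∃ u, θ x₀ u ≠ 0 := by
      by_contra! h
      exact hne x₀ hx₀ (ContinuousLinearMap.ext h)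
    have h1 : L z₀ (0, a) (u, 0) = 0 := congrArg (fun T ↦ T (u, (0 : ℝ))) hwa
    rw [hL, curl_coneForm (hθd _ hx₀)] at h1
    have h2 : a = 0 := by
      have h3 : a * θ x₀ u = 0 := by simpa [z₀] using h1
      exact (mul_eq_zero.1 h3).resolve_right hu
    subst h2
    rfl
  -- dim K = dim E + 1 - 2r, so dim W = 2r - 1.
  obtain ⟨W, hW⟩ := Submodule.exists_isCompl (LinearMap.range ρ)
  have hdimρ : finrank ℝ (LinearMap.range ρ) = finrank ℝ K := LinearMap.finrank_range_of_inj hρ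
  have hdimW := Submodule.finrank_add_eq_of_isCompl hW
  let j' : W × K →L[ℝ] (E × ℝ) × K :=
    ((W.subtypeL.comp (ContinuousLinearMap.fst ℝ W K)).prod 0).prod
      (ContinuousLinearMap.snd ℝ W K)
  let j : W × K → (E × ℝ) × K := fun p ↦ (z₀, 0) + j' p
  have hjd : ∀ p, HasFDerivAt j j' p := fun p ↦ j'.hasFDerivAt.const_add _
  have hjs : ContDiff ℝ ∞ j := contDiff_const.add j'.contDiff
  have hj0 : j 0 = (z₀, 0) := by simp [j]
  let U₃ : Set (W × K) := j ⁻¹' (U₂ ∩ O' ×ˢ Set.univ)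
  have hU₃ : IsOpen U₃ := (hU₂.inter (hO'.prod isOpen_univ)).preimage hjs.continuous
  have h0U₃ : (0 : W × K) ∈ U₃ := by
    change j 0 ∈ U₂ ∩ O' ×ˢ Set.univ
    rw [hj0]
    exact ⟨hmem₂, hz₀', Set.mem_univ _⟩
  have hΨj : ContDiffOn ℝ ∞ (fun p ↦ Ψ (j p)) U₃ :=
    hΨ.comp hjs.contDiffOn fun p hp ↦ hp.1
  have hΨjd : ∀ p ∈ U₃, HasFDerivAt (fun p ↦ Ψ (j p)) ((fderiv ℝ Ψ (j p)).comp j') p :=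
    fun p hp ↦ HasFDerivAt.comp (g := Ψ) p ((hΨ.contDiffAt (hU₂.mem_nhds hp.1)).differentiableAt
      (by simp)).hasFDerivAt (hjd p)
  let Y : W × K → E := fun p ↦ (Ψ (j p)).1
  have hY : ContDiffOn ℝ ∞ Y U₃ := contDiff_fst.comp_contDiffOn hΨj
  have hYd : ∀ p ∈ U₃, HasFDerivAt Y
      ((ContinuousLinearMap.fst ℝ E ℝ).comp ((fderiv ℝ Ψ (j p)).comp j')) p :=
    fun p hp ↦ HasFDerivAt.comp (g := Prod.fst) p hasFDerivAt_fst (hΨjd p hp)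
  have hYd0 : ∀ w n, (ContinuousLinearMap.fst ℝ E ℝ).comp ((fderiv ℝ Ψ (j 0)).comp j') (w, n) =
      w + ρ n := by
    intro w n
    have h1 : fderiv ℝ Ψ (z₀, 0) (((w : E), 0), n) = ((w : E), 0) + (n : E × ℝ) := by
      rw [hΨ']
      congr 1
      exact hA0 n
    rw [hj0]
    exact congrArg Prod.fst h1
  have hYinj : Function.Injective ((ContinuousLinearMap.fst ℝ E ℝ).comp
      ((fderiv ℝ Ψ (j 0)).comp j')).toLinearMap := by
    rw [injective_iff_map_eq_zero]
    rintro ⟨w, n⟩ hwn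
    have h1 : (w : E) + ρ n = 0 := (hYd0 w n).symm.trans hwn
    have h2 : (w : E) ∈ LinearMap.range ρ := by
      rw [eq_neg_of_add_eq_zero_left h1]
      exact neg_mem ⟨n, rfl⟩
    have h3 : (w : E) = 0 := Submodule.disjoint_def.1 hW.disjoint _ h2 w.2
    have h4 : n = 0 := hρ (by rw [map_zero, ← h1, h3, zero_add])
    rw [h4, Submodule.coe_eq_zero.1 h3]
    rfl
  let Y' : (W × K) ≃L[ℝ] E := (LinearEquiv.ofInjectiveOfFinrankEq _ hYinj (by
    rw [finrank_prod]
    omega)).toContinuousLinearEquiv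
  have hY' : HasFDerivAt Y (Y' : W × K →L[ℝ] E) 0 :=
    (hYd 0 h0U₃).congr_fderiv (ContinuousLinearMap.ext fun _ ↦ rfl)
  obtain ⟨e, heY, he0, heU, hes⟩ := exists_smooth_localInverse hU₃ hY h0U₃ Y' hY'
  have hsU : ∀ y ∈ e.target, e.symm y ∈ U₃ := fun y hy ↦ heU (e.map_target hy)
  have hYs : ∀ y ∈ e.target, Y (e.symm y) = y := fun y hy ↦ by
    rw [← heY]
    exact e.right_inv hy
  let g : E → ℝ := fun y ↦ (Ψ (j (e.symm y))).2
  let H : E → E := fun y ↦ x₀ + (e.symm y).1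
  have hg : ContDiffOn ℝ ∞ g e.target :=
    contDiff_snd.comp_contDiffOn (hΨj.comp hes hsU)
  have hHs : ContDiffOn ℝ ∞ H e.target :=
    contDiffOn_const.add (W.subtypeL.contDiff.comp_contDiffOn (contDiff_fst.comp_contDiffOn hes))
  have hΨO : ∀ y ∈ e.target, Ψ (j (e.symm y)) ∈ O := fun y hy ↦
    hO'O (hΨU _ (hsU y hy).1).1
  have hVU : e.target ⊆ U := fun y hy ↦ by
    rw [← hYs y hy]
    exact (hΨO y hy).1
  have hgne : ∀ y ∈ e.target, g y ≠ 0 := fun y hy ↦ ne_of_gt (hΨO y hy).2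
  have hHU : ∀ y ∈ e.target, H y ∈ U := fun y hy ↦ (hO'O (hsU y hy).2.1).1
  have hsd : ∀ y ∈ e.target, HasFDerivAt e.symm (fderiv ℝ e.symm y) y := fun y hy ↦
    ((hes.contDiffAt (e.open_target.mem_nhds hy)).differentiableAt (by simp)).hasFDerivAt
  have hHd : ∀ y ∈ e.target, fderiv ℝ H y =
      (W.subtypeL.comp (ContinuousLinearMap.fst ℝ W K)).comp (fderiv ℝ e.symm y) := fun y hy ↦
    (((W.subtypeL.comp (ContinuousLinearMap.fst ℝ W K)).hasFDerivAt.comp y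
      (hsd y hy)).const_add x₀).fderiv
  have hpull : ∀ y ∈ e.target, g y • θ y = (θ (H y)).comp (fderiv ℝ H y) := by
    intro y hy
    ext v
    have h1 := (hYd _ (hsU y hy)).comp y (hsd y hy)
    have h2 := h1.congr_of_eventuallyEq (f₁ := id)
      (Filter.eventuallyEq_of_mem (e.open_target.mem_nhds hy) fun p hp ↦ (hYs p hp).symm)
    have h3 := congrArg (fun T ↦ T v) (h2.unique (hasFDerivAt_id y))
    set p := fderiv ℝ e.symm y v with hp
    have h4 : (fderiv ℝ Ψ (j (e.symm y)) (((p.1 : E), (0 : ℝ)), p.2)).1 = v := h3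
    -- Invariance of the cone form under Ψ: the left side is gθ at y, and the right side is θ at H y
    -- because the slice sits at height t = 1.
    have h5 := (hΨU _ (hsU y hy).1).2 ((p.1 : E), (0 : ℝ)) p.2
    rw [coneForm_apply, coneForm_apply, h4] at h5
    have h6 : (Ψ (j (e.symm y))).1 = y := hYs y hy
    have h7 : (j (e.symm y)).1.2 = 1 := by simp [j, j', z₀]
    have h8 : (j (e.symm y)).1.1 = H y := rfl
    rw [h6, h7, h8, one_mul] at h5
    rw [hHd y hy]
    exact h5
  refine ⟨e.target, hVU, e.open_target, ?_, g, hg, hgne, fun y hy ↦ ?_⟩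
  · have h1 : Y 0 = x₀ := by
      change (Ψ (j 0)).1 = x₀
      rw [hj0, hΨ0]
    rw [← h1, ← heY]
    exact e.map_source he0
  · have hgd : DifferentiableAt ℝ g y :=
      (hg.contDiffAt (e.open_target.mem_nhds hy)).differentiableAt (by simp)
    -- This bounds the class below by 2r - 1; the bound on the rank of H gives the opposite
    -- inequality.
    have h1 := finrank_localCharSpace_smul_le (hθd y (hVU hy)) hgd (hgne y hy)
    have h2 : LinearMap.ker (fderiv ℝ H y).toLinearMap ≤
        localCharSpace (fun x ↦ g x • θ x) y := by
      rw [localCharSpace_congr (Filter.eventuallyEq_of_mem (e.open_target.mem_nhds hy) hpull)]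
      exact ker_fderiv_le_localCharSpace (hθd _ (hHU y hy))
        (hHs.contDiffAt (e.open_target.mem_nhds hy))
    have h3 := Submodule.finrank_mono h2
    have h4 := LinearMap.finrank_range_add_finrank_ker (fderiv ℝ H y).toLinearMap
    have h5 : finrank ℝ (LinearMap.range (fderiv ℝ H y).toLinearMap) ≤ finrank ℝ W := by
      refine Submodule.finrank_mono ?_
      rintro _ ⟨v, rfl⟩
      rw [hHd y hy]
      exact Submodule.coe_mem _
    have h6 := hdim y (hVU hy)
    have h7 := Submodule.finrank_quotient_add_finrank (localCharSpace (fun x ↦ g x • θ x) y)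
    omega

end LocalForms

/-! ### Expressions of 1-forms in charts -/

section Charts

open Module

variable {E : Type*} [NormedAddCommGroup E] [NormedSpace ℝ E]
  {M : Type*} [TopologicalSpace M] [ChartedSpace E M]

/-- The expression of `η` in the preferred chart at `x`, as a field of linear forms. -/
def localForm (η : (x : M) → (TangentSpace 𝓘(ℝ, E) x →L[ℝ] ℝ)) (x : M) (u : E) : E →L[ℝ] ℝ :=
  (η ((extChartAt 𝓘(ℝ, E) x).symm u)).comp
    (mfderiv 𝓘(ℝ, E) 𝓘(ℝ, E) (extChartAt 𝓘(ℝ, E) x).symm u)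

theorem localForm_smul (η : (x : M) → (TangentSpace 𝓘(ℝ, E) x →L[ℝ] ℝ)) (g : M → ℝ) (x : M)
    (u : E) : localForm (fun z ↦ g z • η z) x u =
      g ((extChartAt 𝓘(ℝ, E) x).symm u) • localForm η x u := rfl

theorem oneFormInChart_eq (η : (x : M) → (TangentSpace 𝓘(ℝ, E) x →L[ℝ] ℝ)) (x : M) :
    oneFormInChart η x = fun u ↦
      ContinuousAlternatingMap.ofSubsingleton ℝ E ℝ (0 : Fin 1) (localForm η x u) := rfl

theorem extDeriv_ofSubsingleton_apply {θ : E → E →L[ℝ] ℝ} {y : E} (hθ : DifferentiableAt ℝ θ y)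
    (v w : E) :
    extDeriv (fun u ↦ ContinuousAlternatingMap.ofSubsingleton ℝ E ℝ (0 : Fin 1) (θ u)) y ![v, w] =
      curl θ y v w := by
  have hd : DifferentiableAt ℝ
      (fun u ↦ ContinuousAlternatingMap.ofSubsingleton ℝ E ℝ (0 : Fin 1) (θ u)) y :=
    (ContinuousAlternatingMap.ofSubsingletonLIE (𝕜 := ℝ) (E := E) (F := ℝ) (0 : Fin 1)).differentiableAt.comp y hθ
  have happ : ∀ v, fderiv ℝ (fun u ↦ θ u v) y = (fderiv ℝ θ y).flip v := fun v ↦ by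
    rw [fderiv_clm_apply hθ (differentiableAt_const v)]
    ext
    simp
  rw [extDeriv_apply hd, Fin.sum_univ_two, curl_apply]
  simp [Fin.removeNth, happ, sub_eq_add_neg]

variable [IsManifold 𝓘(ℝ, E) ∞ M]

theorem mdifferentiableAt_extChartAt_symm {x : M} {u : E}
    (hu : u ∈ (extChartAt 𝓘(ℝ, E) x).target) :
    MDifferentiableAt 𝓘(ℝ, E) 𝓘(ℝ, E) (extChartAt 𝓘(ℝ, E) x).symm u :=
  ((contMDiffOn_extChartAt_symm (n := ∞) x).contMDiffAt
    ((isOpen_extChartAt_target x).mem_nhds hu)).mdifferentiableAt (by simp)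

/-- The change of coordinates from the chart at `x` to the chart at `x'`. -/
def coordChange (x x' : M) (u : E) : E :=
  extChartAt 𝓘(ℝ, E) x' ((extChartAt 𝓘(ℝ, E) x).symm u)

theorem eventually_mem_source {x x' : M} {u : E} (hu : u ∈ (extChartAt 𝓘(ℝ, E) x).target)
    (hu' : (extChartAt 𝓘(ℝ, E) x).symm u ∈ (extChartAt 𝓘(ℝ, E) x').source) :
    ∀ᶠ v in 𝓝 u, v ∈ (extChartAt 𝓘(ℝ, E) x).target ∧
      (extChartAt 𝓘(ℝ, E) x).symm v ∈ (extChartAt 𝓘(ℝ, E) x').source :=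
  ((isOpen_extChartAt_target x).eventually_mem hu).and
    ((mdifferentiableAt_extChartAt_symm hu).continuousAt
      ((isOpen_extChartAt_source x').mem_nhds hu'))

theorem contDiffAt_coordChange {x x' : M} {u : E} (hu : u ∈ (extChartAt 𝓘(ℝ, E) x).target)
    (hu' : (extChartAt 𝓘(ℝ, E) x).symm u ∈ (extChartAt 𝓘(ℝ, E) x').source) :
    ContDiffAt ℝ ∞ (coordChange x x') u := by
  rw [extChartAt_source] at hu'
  exact ((contMDiffAt_extChartAt' (I := 𝓘(ℝ, E)) (n := ∞) hu').comp u
    ((contMDiffOn_extChartAt_symm (n := ∞) x).contMDiffAt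
      ((isOpen_extChartAt_target x).mem_nhds hu))).contDiffAt

theorem localForm_eq_pullback (η : (x : M) → (TangentSpace 𝓘(ℝ, E) x →L[ℝ] ℝ)) {x x' : M} {u : E}
    (hu : u ∈ (extChartAt 𝓘(ℝ, E) x).target)
    (hu' : (extChartAt 𝓘(ℝ, E) x).symm u ∈ (extChartAt 𝓘(ℝ, E) x').source) :
    localForm η x u =
      (localForm η x' (coordChange x x' u)).comp (fderiv ℝ (coordChange x x') u) := by
  have h1 : (extChartAt 𝓘(ℝ, E) x').symm (coordChange x x' u) =
      (extChartAt 𝓘(ℝ, E) x).symm u := (extChartAt 𝓘(ℝ, E) x').left_inv hu'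
  have h2 : (extChartAt 𝓘(ℝ, E) x).symm =ᶠ[𝓝 u]
      (extChartAt 𝓘(ℝ, E) x').symm ∘ coordChange x x' :=
    (eventually_mem_source hu hu').mono fun v hv ↦
      ((extChartAt 𝓘(ℝ, E) x').left_inv hv.2).symm
  have h3 : mfderiv 𝓘(ℝ, E) 𝓘(ℝ, E) (extChartAt 𝓘(ℝ, E) x).symm u =
      (mfderiv 𝓘(ℝ, E) 𝓘(ℝ, E) (extChartAt 𝓘(ℝ, E) x').symm (coordChange x x' u)).comp
        (mfderiv 𝓘(ℝ, E) 𝓘(ℝ, E) (coordChange x x') u) := by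
    rw [h2.mfderiv_eq]
    exact mfderiv_comp u
      (mdifferentiableAt_extChartAt_symm ((extChartAt 𝓘(ℝ, E) x').map_source hu'))
      (((contDiffAt_coordChange hu hu').differentiableAt (by simp)).mdifferentiableAt)
  rw [mfderiv_eq_fderiv] at h3
  ext v
  simp only [localForm, ContinuousLinearMap.comp_apply]
  rw [h3, h1]
  rfl

/-- The tangent trivialization at x is given by the derivative of the chart at x, so the bundle
coordinates of η agree with its chart expression. -/
theorem contDiffAt_localForm_self {η : (x : M) → (TangentSpace 𝓘(ℝ, E) x →L[ℝ] ℝ)}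
    (hη : IsSmoothOneForm η) (x : M) :
    ContDiffAt ℝ ∞ (localForm η x) (extChartAt 𝓘(ℝ, E) x x) := by
  have h1 := ((contMDiffAt_hom_bundle _).1 (hη x)).2
  have h2 := (contMDiffOn_extChartAt_symm (I := 𝓘(ℝ, E)) (n := ∞) x).contMDiffAt
    (extChartAt_target_mem_nhds (I := 𝓘(ℝ, E)) x)
  have h3 := (ContMDiffAt.comp_of_eq h1 h2 (extChartAt_to_inv x)).contDiffAt
  refine h3.congr_of_eventuallyEq ?_
  filter_upwards [extChartAt_target_mem_nhds (I := 𝓘(ℝ, E)) x] with u hu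
  have hs : (extChartAt 𝓘(ℝ, E) x).symm u ∈ (chartAt E x).source := by
    rw [← extChartAt_source 𝓘(ℝ, E)]
    exact (extChartAt 𝓘(ℝ, E) x).map_target hu
  have : IsManifold 𝓘(ℝ, E) 1 M := IsManifold.of_le (n := ∞) (by norm_cast)
  have h4 := TangentBundle.symmL_trivializationAt (𝕜 := ℝ) (I := 𝓘(ℝ, E)) hs
  rw [(extChartAt 𝓘(ℝ, E) x).right_inv hu, modelWithCornersSelf_coe, Set.range_id,
    mfderivWithin_univ] at h4
  ext v
  simp only [Function.comp_apply, ContinuousLinearMap.inCoordinates, localForm,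
    ContinuousLinearMap.comp_apply]
  rw [h4]
  simp
  rfl

/-- Near any other point, the expression is the pullback of the one in the chart centred there. -/
theorem contDiffOn_localForm {η : (x : M) → (TangentSpace 𝓘(ℝ, E) x →L[ℝ] ℝ)}
    (hη : IsSmoothOneForm η) (x : M) :
    ContDiffOn ℝ ∞ (localForm η x) (extChartAt 𝓘(ℝ, E) x).target := by
  intro u hu
  set y := (extChartAt 𝓘(ℝ, E) x).symm u with hy
  have hu' : (extChartAt 𝓘(ℝ, E) x).symm u ∈ (extChartAt 𝓘(ℝ, E) y).source :=
    mem_extChartAt_source (I := 𝓘(ℝ, E)) y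
  have hc := contDiffAt_coordChange hu hu'
  have h1 : ContDiffAt ℝ ∞ (localForm η y) (coordChange x y u) :=
    contDiffAt_localForm_self hη y
  have h2 := (ContDiffAt.comp u h1 hc).clm_comp (hc.fderiv_right (m := ∞) (by simp))
  refine (h2.congr_of_eventuallyEq ?_).contDiffWithinAt
  exact (eventually_mem_source hu hu').mono fun v hv ↦ localForm_eq_pullback η hv.1 hv.2

/-- The class of a 1-form can be computed in any chart. -/
theorem formClass_eq {η : (x : M) → (TangentSpace 𝓘(ℝ, E) x →L[ℝ] ℝ)} {x y : M}
    (hy : y ∈ (extChartAt 𝓘(ℝ, E) x).source)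
    (hη : DifferentiableAt ℝ (localForm η x) (extChartAt 𝓘(ℝ, E) x y)) :
    formClass η y = finrank ℝ (E ⧸ localCharSpace (localForm η x) (extChartAt 𝓘(ℝ, E) x y)) := by
  have : IsManifold 𝓘(ℝ, E) 1 M := IsManifold.of_le (n := ∞) (by norm_cast)
  set u := extChartAt 𝓘(ℝ, E) x y with hu
  set v := extChartAt 𝓘(ℝ, E) y y with hv
  have hvt : v ∈ (extChartAt 𝓘(ℝ, E) y).target := mem_extChartAt_target y
  have hyv : (extChartAt 𝓘(ℝ, E) y).symm v = y := extChartAt_to_inv y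
  have hvs : (extChartAt 𝓘(ℝ, E) y).symm v ∈ (extChartAt 𝓘(ℝ, E) x).source := by rwa [hyv]
  have hcv : coordChange y x v = u := by rw [coordChange, hyv]
  have hc := contDiffAt_coordChange hvt hvs
  obtain ⟨D, hD⟩ : ∃ D : TangentSpace 𝓘(ℝ, E) y ≃L[ℝ] E,
      ∀ w, mfderiv 𝓘(ℝ, E) 𝓘(ℝ, E) (extChartAt 𝓘(ℝ, E) x) y w = D w := by
    obtain ⟨D, hD⟩ := isInvertible_mfderiv_extChartAt (I := 𝓘(ℝ, E)) hy
    exact ⟨D, fun w ↦ congrArg (fun T ↦ T w) hD.symm⟩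
  have hDc : mfderiv 𝓘(ℝ, E) 𝓘(ℝ, E) (extChartAt 𝓘(ℝ, E) x) y =
      (fderiv ℝ (coordChange y x) v).comp
        (mfderiv 𝓘(ℝ, E) 𝓘(ℝ, E) (extChartAt 𝓘(ℝ, E) y) y) := by
    have h1 : extChartAt 𝓘(ℝ, E) x =ᶠ[𝓝 y] coordChange y x ∘ extChartAt 𝓘(ℝ, E) y := by
      filter_upwards [extChartAt_source_mem_nhds (I := 𝓘(ℝ, E)) y] with z hz
      rw [Function.comp_apply, coordChange, (extChartAt 𝓘(ℝ, E) y).left_inv hz]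
    rw [h1.mfderiv_eq, ← mfderiv_eq_fderiv]
    exact mfderiv_comp y ((hc.differentiableAt (by simp)).mdifferentiableAt)
      (mdifferentiableAt_extChartAt (mem_chart_source E y))
  have hform : ∀ w, η y w = localForm η x u (D w) := by
    intro w
    have h1 := mfderivWithin_extChartAt_symm_comp_mfderiv_extChartAt' (I := 𝓘(ℝ, E)) hy
    rw [modelWithCornersSelf_coe, Set.range_id, mfderivWithin_univ] at h1
    have h2 := congrArg (fun T ↦ T w) h1
    have h3 : (extChartAt 𝓘(ℝ, E) x).symm u = y := (extChartAt 𝓘(ℝ, E) x).left_inv hy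
    have h4 : mfderiv 𝓘(ℝ, E) 𝓘(ℝ, E) (extChartAt 𝓘(ℝ, E) x).symm u (D w) = w := by
      rw [← hD]
      exact h2
    have h5 : ∀ z (_ : z = y) (a : E), (η z : E →L[ℝ] ℝ) a = (η y : E →L[ℝ] ℝ) a := by
      rintro _ rfl _
      rfl
    exact ((congrArg (fun a : E ↦
      (η ((extChartAt 𝓘(ℝ, E) x).symm u) : E →L[ℝ] ℝ) a) h4).trans (h5 _ h3 w)).symm
  -- The exterior derivative at y is defined in the chart at y; its compatibility with pullback by
  -- the coordinate change moves it to the chart at x.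
  have hext : ∀ w w', mextDeriv η y ![w, w'] = curl (localForm η x) u (D w) (D w') := by
    intro w w'
    have hd : DifferentiableAt ℝ (oneFormInChart η x) (coordChange y x v) := by
      rw [hcv]
      exact (ContinuousAlternatingMap.ofSubsingletonLIE (𝕜 := ℝ) (E := E) (F := ℝ)
        (0 : Fin 1)).differentiableAt.comp u hη
    have h1 : oneFormInChart η y =ᶠ[𝓝 v] fun a ↦
        (oneFormInChart η x (coordChange y x a)).compContinuousLinearMap
          (fderiv ℝ (coordChange y x) a) := by
      refine (eventually_mem_source hvt hvs).mono fun a ha ↦ ?_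
      have h2 := localForm_eq_pullback η ha.1 ha.2
      rw [oneFormInChart_eq, oneFormInChart_eq]
      beta_reduce
      rw [h2]
      rfl
    rw [mextDeriv, h1.extDeriv_eq, extDeriv_pullback hd hc (by simp; norm_cast), hcv]
    have h3 : ∀ w, fderiv ℝ (coordChange y x) v
        (mfderiv 𝓘(ℝ, E) 𝓘(ℝ, E) (extChartAt 𝓘(ℝ, E) y) y w) = D w := fun w ↦ by
      rw [← hD, hDc]
      rfl
    refine Eq.trans ?_ (extDeriv_ofSubsingleton_apply hη (D w) (D w'))
    refine congrArg (extDeriv (oneFormInChart η x) u) (funext fun i ↦ ?_)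
    fin_cases i
    · exact h3 w
    · exact h3 w'
  rw [formClass, pairClass]
  refine LinearEquiv.finrank_eq (Submodule.Quotient.equiv _ _ D.toLinearEquiv ?_)
  ext p
  rw [Submodule.mem_map_equiv, mem_localCharSpace, charSpace, Submodule.mem_inf,
    LinearMap.mem_ker, mem_twoFormKer]
  have hDs : ∀ q, D (D.toLinearEquiv.symm q) = q := fun q ↦ D.apply_symm_apply q
  refine and_congr ?_ ⟨fun h w ↦ ?_, fun h w ↦ ?_⟩
  · change η y (D.toLinearEquiv.symm p) = 0 ↔ _
    rw [hform, hDs]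
  · have := h (D.toLinearEquiv.symm w)
    rwa [hext, hDs, hDs] at this
  · rw [hext, hDs]
    exact h _

end Charts

end PrecontactClass

end

theorem mainTheorem7
    {E : Type*} [NormedAddCommGroup E] [NormedSpace ℝ E] [FiniteDimensional ℝ E]
    {M : Type*} [TopologicalSpace M] [ChartedSpace E M] [IsManifold 𝓘(ℝ, E) ∞ M]
    (η : (x : M) → (TangentSpace 𝓘(ℝ, E) x →L[ℝ] ℝ))
    (hη : PrecontactClass.IsSmoothOneForm η)
    (hη0 : ∀ x : M, η x ≠ 0)
    (r : ℕ) (hclass : ∀ x : M, PrecontactClass.formClass η x = 2 * r)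
    (x : M) :
    ∃ V : Set M, IsOpen V ∧ x ∈ V ∧
      ∃ g : M → ℝ, ContMDiffOn 𝓘(ℝ, E) 𝓘(ℝ, ℝ) ∞ g V ∧ (∀ y ∈ V, g y ≠ 0) ∧
        ∀ y ∈ V, PrecontactClass.formClass (fun z : M ↦ g z • η z) y = 2 * r - 1 := by
  have hθ := PrecontactClass.contDiffOn_localForm hη x
  set φ := extChartAt 𝓘(ℝ, E) x with hφ
  have hU : IsOpen φ.target := isOpen_extChartAt_target x
  have hS : IsOpen φ.source := isOpen_extChartAt_source x
  have hθd : ∀ u ∈ φ.target, DifferentiableAt ℝ (PrecontactClass.localForm η x) u :=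
    fun u hu ↦ (hθ.contDiffAt (hU.mem_nhds hu)).differentiableAt (by simp)
  have : IsManifold 𝓘(ℝ, E) 1 M := IsManifold.of_le (n := ∞) (by norm_cast)
  obtain ⟨V, hVU, hV, hxV, g, hg, hgne, hgc⟩ := PrecontactClass.exists_local_rescaling hU hθ
    -- The derivative of the inverse chart is onto, so a zero of the chart expression would be a
    -- zero of η.
    (fun u hu h0 ↦ by
      refine hη0 (φ.symm u) (ContinuousLinearMap.ext fun w ↦ ?_)
      have h1 := mfderivWithin_extChartAt_symm_comp_mfderiv_extChartAt (I := 𝓘(ℝ, E)) hu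
      rw [modelWithCornersSelf_coe, Set.range_id, mfderivWithin_univ] at h1
      have h2 := congrArg (fun T ↦ η (φ.symm u) (T w)) h1
      have h3 := congrArg (fun T : E →L[ℝ] ℝ ↦
        T (mfderiv 𝓘(ℝ, E) 𝓘(ℝ, E) φ (φ.symm u) w)) h0
      exact h2.symm.trans h3)
    (fun u hu ↦ by
      have h1 := PrecontactClass.formClass_eq (η := η) (φ.map_target hu)
      rw [← hφ, φ.right_inv hu] at h1
      rw [← h1 (hθd u hu), hclass]) (mem_extChartAt_target x)
  have hφc : ContMDiffOn 𝓘(ℝ, E) 𝓘(ℝ, E) ∞ φ φ.source := by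
    rw [hφ, extChartAt_source]
    exact contMDiffOn_extChartAt
  refine ⟨φ.source ∩ φ ⁻¹' V, hφc.continuousOn.isOpen_inter_preimage hS hV,
    ⟨mem_extChartAt_source x, hxV⟩, fun y ↦ g (φ y), ?_, fun y hy ↦ hgne _ hy.2,
    fun y hy ↦ ?_⟩
  · exact hg.contMDiffOn.comp (hφc.mono Set.inter_subset_left) fun y hy ↦ hy.2
  · have heq : PrecontactClass.localForm (fun z : M ↦ g (φ z) • η z) x =ᶠ[𝓝 (φ y)]
        fun u ↦ g u • PrecontactClass.localForm η x u := by
      filter_upwards [hV.mem_nhds hy.2] with u hu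
      rw [PrecontactClass.localForm_smul η (fun z ↦ g (φ z)), φ.right_inv (hVU hu)]
    have hd : DifferentiableAt ℝ (fun u ↦ g u • PrecontactClass.localForm η x u) (φ y) :=
      ((hg.contDiffAt (hV.mem_nhds hy.2)).differentiableAt (by simp)).smul
        (hθd _ (hVU hy.2))
    rw [PrecontactClass.formClass_eq hy.1 (hd.congr_of_eventuallyEq heq),
      PrecontactClass.localCharSpace_congr heq, hgc _ hy.2]
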